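/- **Proposition (Incompleteness of closed choice).** Let $\mathsf{C}:=\widehat{\mathsf{LPO}}$ be the parallelization of $\mathsf{LPO}$. Closed choice $\mathsf{C_A}$ on $\mathbb{R}$ is strictly Weihrauch below $\mathsf{C}$: $$\mathsf{C_A}<_{\mathrm W}\mathsf{C},\qquad\text{i.e.}\qquad \mathsf{C_A}\le_{\mathrm W}\mathsf{C}\ \text{ and }\ \mathsf{C}\not\le_{\mathrm W}\mathsf{C_A}.$$ Here the notions are as follows. * A representation of a set $X$ is a surjective partial map $\delta_X:\subseteq\mathbb{N}^{\mathbb N}\to X$; if $\delta_X(p)=x$, then $p$ is called a name of $x$. For a multi-valued partial map $f:\subseteq X\rightrightarrows Y$ put $\mathrm{dom}(f)=\{x: f(x)\neq\emptyset\}$. A partial function $F:\subseteq\mathbb{N}^{\mathbb N}\to\mathbb{N}^{\mathbb N}$ is a realizer of $f$ if $F(p)$ is defined and $\delta_YF(p)\in f(\delta_X(p))$ whenever $\delta_X(p)$ is defined and lies in $\mathrm{dom}(f)$. * $f\le_{\mathrm W}g$ means that there are computable partial functions $H,K:\subseteq\mathbb{N}^{\mathbb N}\to\mathbb{N}^{\mathbb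 N}$ such that for every realizer $G$ of $g$ the function $p\mapsto H\langle p,GK(p)\rangle$ is a realizer of $f$. * $\mathsf{LPO}:\mathbb{N}^{\mathbb N}\to\mathbb{N}$ has $\mathsf{LPO}(p)=0$ if $p(n)=0$ for some $n$, and $\mathsf{LPO}(p)=1$ otherwise. Its parallelization maps $(p_i)_{i\in\mathbb N}$ to $(\mathsf{LPO}(p_i))_{i\in\mathbb N}$. Here $\mathbb{N}^{\mathbb N}$ is represented by the identity, $n\in\mathbb{N}$ by the constant sequence with value $n$, and a sequence $(x_i)_i$ by $\langle p_0,p_1,\dots\rangle$ with $p_i$ a name of $x_i$. * $\mathsf{C_A}:\subseteq\mathcal{A}_-(\mathbb{R})\rightrightarrows\mathbb{R}$, $A\mapsto A$, is defined on the non-empty closed sets $A\subseteq\mathbb{R}$. A closed set is named by any enumeration of rational open intervals whose union is $\mathbb{R}\setminus A$ (the empty interval is allowed), and a real number $x$ by any sequence of rational numbers $(q_i)_i$ with $|q_i-q_k|\le 2^{-i}$ for $i<k$ and $\lim_i q_i=x$. -/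

import Mathlib

namespace Weihrauch

/-- Baire space `ℕ^ℕ`. -/
abbrev Baire : Type := ℕ → ℕ

/-- The finite initial segment `p(0) … p(n-1)` of `p`, as a word. -/
def initSeg (p : Baire) (n : ℕ) : List ℕ := (List.range n).map p

/-- A partial function `F :⊆ ℕ^ℕ → ℕ^ℕ` is computable if there is a computable function `h` on
finite words, monotone for the prefix order, such that `F(p)` is the infinite sequence that is
approximated by the words `h(p(0)…p(k-1))`, `k = 0, 1, 2, …`. Here `F(p)` is undefined exactly if
these words do not grow to an infinite sequence (type-2 computability: from longer and longer
prefixes of the input longer and longer prefixes of the output are computed, and output symbols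
are never revised). -/
def IsComputable (F : Baire →. Baire) : Prop :=
  ∃ h : List ℕ → List ℕ, Computable h ∧ (∀ u v : List ℕ, u <+: v → h u <+: h v) ∧
    ∀ p q : Baire, q ∈ F p ↔ ∀ n : ℕ, ∃ k : ℕ, initSeg q n <+: h (initSeg p k)

/-- The pairing `⟨p, q⟩ = p(0) q(0) p(1) q(1) …` on Baire space. -/
def pair (p q : Baire) : Baire := fun n => if n % 2 = 0 then p (n / 2) else q (n / 2)

/-- The partial function `H⟨id, G K⟩`, with its natural domain. -/
def sandwich (H K G : Baire →. Baire) : Baire →. Baire := fun p =>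
  (K p).bind fun r => (G r).bind fun s => H (pair p s)

/-- Weihrauch reducibility of sets of partial functions on Baire space. -/
def SetReducible (𝓕 𝓖 : Set (Baire →. Baire)) : Prop :=
  ∃ H K : Baire →. Baire, IsComputable H ∧ IsComputable K ∧
    ∀ G ∈ 𝓖, ∃ F ∈ 𝓕, F = sandwich H K G

/-- A representation of `X`: a surjective partial map from Baire space to `X`, given through its
graph; `Names p x` says that `p` is in the domain and is mapped to `x`. -/
structure BaireRep (X : Type*) where
  Names : Baire → X → Prop
  unique : ∀ {p : Baire} {x y : X}, Names p x → Names p y → x = y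
  surj : ∀ x : X, ∃ p : Baire, Names p x

/-- A multi-valued partial function `f :⊆ X ⇉ Y`; its domain is `{x | f x ≠ ∅}`. -/
abbrev MultiFun (X Y : Type*) := X → Set Y

/-- `F ⊢ f`: for each name `p` of a point `x` of the domain of `f`, the value `F(p)` is defined
and is a name of some element of `f(x)`. -/
def IsRealizer {X Y : Type*} (δX : BaireRep X) (δY : BaireRep Y) (F : Baire →. Baire)
    (f : MultiFun X Y) : Prop :=
  ∀ (p : Baire) (x : X), δX.Names p x → (f x).Nonempty →
    ∃ q ∈ F p, ∃ y ∈ f x, δY.Names q y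

/-- A multi-valued partial function between represented spaces. -/
structure Problem (X Y : Type*) where
  dom : BaireRep X
  cod : BaireRep Y
  toFun : MultiFun X Y

/-- The set of realizers of `f`. -/
def Problem.realizers {X Y : Type*} (f : Problem X Y) : Set (Baire →. Baire) :=
  {F | IsRealizer f.dom f.cod F f.toFun}

/-- Weihrauch reducibility `f ≤_W g`. -/
def Reducible {X Y U V : Type*} (f : Problem X Y) (g : Problem U V) : Prop :=
  SetReducible f.realizers g.realizers

/-- Strict Weihrauch reducibility `f <_W g`. -/
def StrictReducible {X Y U V : Type*} (f : Problem X Y) (g : Problem U V) : Prop :=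
  Reducible f g ∧ ¬ Reducible g f

/-! ### Sequences and parallelization -/

/-- The representation of `X^ℕ`: `⟨p₀, p₁, …⟩` with `⟨p₀, p₁, …⟩⟨i, j⟩ = pᵢ(j)` names `(xᵢ)ᵢ` if
each `pᵢ` names `xᵢ`. -/
def BaireRep.seq {X : Type*} (δ : BaireRep X) : BaireRep (ℕ → X) where
  Names p x := ∀ i, δ.Names (fun j => p (Nat.pair i j)) (x i)
  unique hx hy := funext fun i => δ.unique (hx i) (hy i)
  surj x := by
    choose p hp using δ.surj
    exact ⟨fun n => p (x n.unpair.1) n.unpair.2, fun i => by simpa using hp (x i)⟩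

/-- The parallelization `f̂ (xᵢ)ᵢ = ∏ᵢ f(xᵢ)`. -/
def Problem.parallelization {X Y : Type*} (f : Problem X Y) : Problem (ℕ → X) (ℕ → Y) where
  dom := f.dom.seq
  cod := f.cod.seq
  toFun x := {y | ∀ i, y i ∈ f.toFun (x i)}

/-! ### The omniscience principle `LPO` and `C` -/

/-- Baire space is represented by the identity. -/
def baireRep : BaireRep Baire where
  Names p x := p = x
  unique h h' := h.symm.trans h'
  surj x := ⟨x, rfl⟩

/-- The number `n` has exactly one name, the constant sequence with value `n`. -/
def natRep : BaireRep ℕ where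
  Names p n := p = fun _ => n
  unique h h' := congrFun (h.symm.trans h') 0
  surj n := ⟨fun _ => n, rfl⟩

open Classical in
/-- `LPO(p) = 0` if `p(n) = 0` for some `n`, and `LPO(p) = 1` otherwise. -/
noncomputable def LPO : Problem Baire ℕ where
  dom := baireRep
  cod := natRep
  toFun p := {if ∃ n, p n = 0 then 0 else 1}

/-- `C`, the parallelization of `LPO`. -/
noncomputable def C : Problem (ℕ → Baire) (ℕ → ℕ) := LPO.parallelization

/-! ### Closed choice on the real line -/

/-- The standard numbering of the rationals, `⟨⟨i, j⟩, k⟩ ↦ (i - j) / (k + 1)`. -/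
def nuQ (n : ℕ) : ℚ :=
  ((n.unpair.1.unpair.1 : ℚ) - (n.unpair.1.unpair.2 : ℚ)) / ((n.unpair.2 : ℚ) + 1)

theorem nuQ_surjective : Function.Surjective nuQ := by
  intro q
  refine ⟨Nat.pair (Nat.pair q.num.toNat (-q.num).toNat) (q.den - 1), ?_⟩
  have h1 : ((q.den - 1 : ℕ) : ℚ) + 1 = q.den := by
    have := q.pos
    exact_mod_cast Nat.sub_add_cancel this
  have h2 : ((q.num.toNat : ℕ) : ℚ) - ((-q.num).toNat : ℕ) = q.num := by
    have : ((q.num.toNat : ℕ) : ℤ) - ((-q.num).toNat : ℕ) = q.num := by omega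
    exact_mod_cast this
  simp only [nuQ, Nat.unpair_pair, h1, h2]
  exact Rat.num_div_den q

/-- The Cauchy representation `ρ` of the reals: `p` names `x` if the rationals `nuQ (p i)` satisfy
`|nuQ (p i) - nuQ (p k)| ≤ 2^{-i}` for all `i < k` and converge to `x`. -/
def realRep : BaireRep ℝ where
  Names p x := (∀ i k : ℕ, i < k → |nuQ (p i) - nuQ (p k)| ≤ (1 / 2 : ℚ) ^ i) ∧
    Filter.Tendsto (fun i => (nuQ (p i) : ℝ)) Filter.atTop (nhds x)
  unique h h' := tendsto_nhds_unique h.2 h'.2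
  surj x := by
    have h1 : ∀ i : ℕ, ∃ n : ℕ, |(nuQ n : ℝ) - x| < (1 / 2 : ℝ) ^ (i + 1) := by
      intro i
      have hpos : (0 : ℝ) < (1 / 2 : ℝ) ^ (i + 1) := by positivity
      obtain ⟨q, hq⟩ := Rat.denseRange_cast.exists_dist_lt x hpos
      obtain ⟨n, rfl⟩ := nuQ_surjective q
      exact ⟨n, by rwa [dist_comm, Real.dist_eq] at hq⟩
    choose p hp using h1
    refine ⟨p, ?_, ?_⟩
    · intro i k hik
      have hpow : (1 / 2 : ℝ) ^ (k + 1) ≤ (1 / 2 : ℝ) ^ (i + 1) :=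
        pow_le_pow_of_le_one (by norm_num) (by norm_num) (by omega)
      have hi := abs_lt.1 (hp i)
      have hk := abs_lt.1 (hp k)
      have hsucc : (1 / 2 : ℝ) ^ (i + 1) = (1 / 2 : ℝ) ^ i / 2 := by ring
      have : |(nuQ (p i) : ℝ) - nuQ (p k)| ≤ (1 / 2 : ℝ) ^ i := by
        rw [abs_le]
        constructor <;> linarith [hi.1, hi.2, hk.1, hk.2]
      have h2 : ((|nuQ (p i) - nuQ (p k)| : ℚ) : ℝ) ≤ (((1 / 2 : ℚ) ^ i : ℚ) : ℝ) := by
        push_cast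
        exact this
      exact Rat.cast_le.1 h2
    · rw [tendsto_iff_dist_tendsto_zero]
      refine squeeze_zero (fun _ => dist_nonneg) (fun i => ?_)
        (tendsto_pow_atTop_nhds_zero_of_lt_one (r := (1 / 2 : ℝ)) (by norm_num) (by norm_num))
      rw [Real.dist_eq]
      exact (hp i).le.trans
        (pow_le_pow_of_le_one (by norm_num) (by norm_num) (Nat.le_succ i))

/-- The rational open ball with code `⟨c, r⟩`: center `nuQ c`, radius `nuQ r` (it is empty if the
radius is not positive). -/
def ratBall (n : ℕ) : Set ℝ := Metric.ball (nuQ n.unpair.1 : ℝ) (nuQ n.unpair.2 : ℝ)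

/-- The negative information representation `ψ₋` of the closed subsets of `ℝ`: `p` names `A` if
the rational open balls with codes `p(0), p(1), …` exhaust the complement of `A`. -/
def closedRep : BaireRep (TopologicalSpace.Closeds ℝ) where
  Names p A := (A : Set ℝ)ᶜ = ⋃ i, ratBall (p i)
  unique h h' := by
    apply SetLike.coe_injective
    exact compl_injective (h.trans h'.symm)
  surj A := by
    classical
    obtain ⟨z, hz⟩ := nuQ_surjective 0
    have hempty : ratBall (Nat.pair z z) = ∅ := by simp [ratBall, hz]
    refine ⟨fun n => if ratBall n ⊆ (A : Set ℝ)ᶜ then n else Nat.pair z z, ?_⟩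
    apply Set.Subset.antisymm
    · intro x hx
      obtain ⟨ε, hε, hball⟩ := Metric.isOpen_iff.1 A.isClosed.isOpen_compl x hx
      obtain ⟨r, hr0, hr⟩ := exists_rat_btwn (half_pos hε)
      obtain ⟨c, hc⟩ := Rat.denseRange_cast.exists_dist_lt x hr0
      obtain ⟨m, rfl⟩ := nuQ_surjective r
      obtain ⟨n, rfl⟩ := nuQ_surjective c
      have hsub : ratBall (Nat.pair n m) ⊆ (A : Set ℝ)ᶜ := by
        refine Set.Subset.trans (fun y hy => ?_) hball
        simp only [ratBall, Nat.unpair_pair, Metric.mem_ball] at hy ⊢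
        have := dist_triangle y (nuQ n : ℝ) x
        rw [dist_comm (nuQ n : ℝ) x] at this
        linarith
      refine Set.mem_iUnion.2 ⟨Nat.pair n m, ?_⟩
      simp only [if_pos hsub]
      simpa [ratBall] using hc
    · refine Set.iUnion_subset fun n => ?_
      dsimp only
      split_ifs with h
      · exact h
      · simp [hempty]

/-- Closed choice `C_A :⊆ 𝒜₋(ℝ) ⇉ ℝ`, `A ↦ A`, whose domain consists of the non-empty closed
sets. -/
def closedChoice : Problem (TopologicalSpace.Closeds ℝ) ℝ where
  dom := closedRep
  cod := realRep
  toFun A := (A : Set ℝ)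

end Weihrauch

namespace Weihrauch

/-! Upper bound. Whether a compact dyadic interval misses the closed set `A` is semi-decidable from
a name of `A`: by compactness finitely many enumerated balls cover the interval, and a finite stage
certifies this. `K` turns each interval into an instance of `LPO` that has a zero exactly if the
interval misses `A` (`exists_covers_iff`). From the answers `H` finds a unit interval that meets `A`
and bisects it (`exists_bisect`); the left endpoints converge to a point of `A` at the required rate
(`exists_realRep_of_dyadic`).

Strictness. Suppose `H` and `K` reduce `C` to closed choice. Then `K` sends each `x` to a name of a
non-empty closed set `A_x`, and `H` must solve `x` from any name of any point of `A_x`. The sets of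
those `x` for which `A_x` meets `[-n, n]` are closed and cover Baire space, so by Baire category one
of them contains a cylinder, of length `L` say. The `L`-th instance of `LPO` is still free there:
take `x` without a zero in it, and `x'_k → x` with a zero at place `k` of it. Points of `A_{x'_k}`
in `[-n, n]` accumulate at some `a ∈ A_x`. On `x` and a name of `a`, `H` commits to a nonzero answer
after a finite prefix; that prefix also fits `x'_k` and a name of a point of `A_{x'_k}` for some
large `k`, where the answer is wrong. -/

/-! ### Computable functions from placewise decisions on prefixes -/

theorem initSeg_length (p : Baire) (n : ℕ) : (initSeg p n).length = n := by
  simp [initSeg]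

theorem initSeg_getElem? (p : Baire) {n i : ℕ} (h : i < n) : (initSeg p n)[i]? = some (p i) := by
  simp [initSeg, h]

theorem range_map_prefix {f g : ℕ → ℕ} {a b : ℕ} (hab : a ≤ b) (hfg : ∀ i < a, f i = g i) :
    (List.range a).map f <+: (List.range b).map g := by
  rw [List.prefix_iff_eq_take, ← List.map_take, List.take_range]
  simp only [List.length_map, List.length_range, min_eq_left hab]
  exact List.map_congr_left fun i hi => hfg i (List.mem_range.1 hi)

theorem initSeg_prefix (p : Baire) {m n : ℕ} (h : m ≤ n) : initSeg p m <+: initSeg p n :=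
  range_map_prefix h fun _ _ => rfl

theorem initSeg_eq_iff {p q : Baire} {n : ℕ} :
    initSeg p n = initSeg q n ↔ ∀ i < n, p i = q i := by
  simp [initSeg]

theorem initSeg_take (p : Baire) {m n : ℕ} (h : m ≤ n) : (initSeg p n).take m = initSeg p m := by
  simp [initSeg, ← List.map_take, List.take_range, h]

/-- The length of the longest initial segment of values decided by `g u`, capped by the length
of `u`. -/
def decidedLength (g : List ℕ → ℕ → Option ℕ) (u : List ℕ) : ℕ :=
  (List.range u.length).findIdx fun n => (g u n).isNone

/-- The word of values decided by `g u`. -/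
def decidedWord (g : List ℕ → ℕ → Option ℕ) (u : List ℕ) : List ℕ :=
  (List.range (decidedLength g u)).map fun n => (g u n).getD 0

theorem lt_decidedLength_iff {g : List ℕ → ℕ → Option ℕ} {u : List ℕ} {n : ℕ} :
    n < decidedLength g u ↔ n < u.length ∧ ∀ m ≤ n, (g u m).isSome := by
  constructor
  · intro h
    have hn : n < u.length := by
      have := List.findIdx_le_length (xs := List.range u.length) (p := fun n => (g u n).isNone)
      rw [List.length_range] at this
      exact h.trans_le this
    refine ⟨hn, fun m hm => ?_⟩
    have := List.not_of_lt_findIdx (hm.trans_lt h)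
    simpa [Option.isSome_iff_ne_none] using this
  · rintro ⟨hn, h⟩
    by_contra hlt
    rw [not_lt] at hlt
    have h1 : decidedLength g u < (List.range u.length).length := by
      rw [List.length_range]; omega
    have h3 : (g u (List.range u.length)[decidedLength g u]).isNone = true :=
      List.findIdx_getElem (w := h1)
    rw [List.getElem_range, Option.isNone_iff_eq_none] at h3
    simpa [h3] using h _ hlt

theorem decidedWord_primrec {g : List ℕ → ℕ → Option ℕ} (hg : Primrec₂ g) :
    Primrec (decidedWord g) := by
  have hN : Primrec₂ fun u n => (g u n).isNone := by
    have : Primrec fun o : Option ℕ => o.isNone :=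
      (Primrec.not.comp Primrec.option_isSome).of_eq fun o => by cases o <;> rfl
    exact this.comp₂ hg
  have hL : Primrec (decidedLength g) :=
    Primrec.list_findIdx (Primrec.list_range.comp Primrec.list_length) hN
  exact Primrec.list_map (Primrec.list_range.comp hL)
    (Primrec.option_getD.comp₂ hg (Primrec₂.const 0))

/-- The partial function on Baire space whose value at place `n` is decided by `g` from a finite
prefix of the argument. -/
noncomputable def approxFun (g : List ℕ → ℕ → Option ℕ) : Baire →. Baire := fun p =>
  ⟨∀ n, ∃ a k, g (initSeg p k) n = some a, fun h n => (h n).choose⟩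

/-- `g` never revises a decided value. -/
def PrefixMonotone (g : List ℕ → ℕ → Option ℕ) : Prop :=
  ∀ u v : List ℕ, u <+: v → ∀ n a, g u n = some a → g v n = some a

theorem mem_approxFun {g : List ℕ → ℕ → Option ℕ} (hmono : PrefixMonotone g) {p q : Baire} :
    q ∈ approxFun g p ↔ ∀ n, ∃ k, g (initSeg p k) n = some (q n) := by
  constructor
  · rintro ⟨h, rfl⟩ n
    exact (h n).choose_spec
  · intro h
    refine ⟨fun n => ⟨q n, h n⟩, ?_⟩
    funext n
    change Exists.choose (_ : ∃ a k, g (initSeg p k) n = some a) = q n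
    generalize_proofs hn
    obtain ⟨k, hk⟩ := hn.choose_spec
    obtain ⟨l, hl⟩ := h n
    have h1 := hmono _ _ (initSeg_prefix p (le_max_left k l)) _ _ hk
    have h2 := hmono _ _ (initSeg_prefix p (le_max_right k l)) _ _ hl
    exact Option.some.inj (h1.symm.trans h2)

/-- The word function outputs the longest gap-free block of decided values. Since decided values are
never revised, this block only grows with the prefix. -/
theorem isComputable_approxFun {g : List ℕ → ℕ → Option ℕ} (hg : Primrec₂ g)
    (hmono : PrefixMonotone g) : IsComputable (approxFun g) := by
  refine ⟨decidedWord g, (decidedWord_primrec hg).to_comp, ?_, ?_⟩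
  · intro u v huv
    have hval : ∀ n, (g u n).isSome → g v n = g u n := by
      intro n hn
      obtain ⟨a, ha⟩ := Option.isSome_iff_exists.1 hn
      rw [ha, hmono u v huv n a ha]
    refine range_map_prefix ?_ ?_
    · by_contra hlt
      rw [not_le, lt_decidedLength_iff] at hlt
      have := lt_decidedLength_iff.2 (⟨hlt.1.trans_le huv.length_le, fun m hm => by
        rw [hval m (hlt.2 m hm)]; exact hlt.2 m hm⟩ :
          decidedLength g v < v.length ∧ ∀ m ≤ decidedLength g v, (g v m).isSome)
      exact lt_irrefl _ this
    · intro i hi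
      rw [hval i ((lt_decidedLength_iff.1 hi).2 i le_rfl)]
  · intro p q
    rw [mem_approxFun hmono]
    constructor
    · intro h n
      choose k hk using h
      -- The `n` defeats the cap by the length of the prefix; the supremum ensures that all places
      -- below `n` are decided.
      refine ⟨max n ((Finset.range n).sup k), range_map_prefix ?_ ?_⟩
      all_goals
        have hall : ∀ i < n, g (initSeg p (max n ((Finset.range n).sup k))) i = some (q i) :=
          fun i hi => hmono _ _ (initSeg_prefix p
            ((Finset.le_sup (Finset.mem_range.2 hi)).trans (le_max_right _ _))) _ _ (hk i)
      · cases n with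
        | zero => exact Nat.zero_le _
        | succ n =>
          refine lt_decidedLength_iff.2 ⟨?_, fun m hm => ?_⟩
          · rw [initSeg_length]
            exact Nat.lt_of_succ_le (le_max_left _ _)
          · rw [hall m (Nat.lt_succ_of_le hm)]
            rfl
      · intro i hi
        rw [hall i hi]
        rfl
    · intro h n
      obtain ⟨k, hk⟩ := h (n + 1)
      refine ⟨k, ?_⟩
      have hlen := hk.length_le
      rw [initSeg_length, decidedWord, List.length_map, List.length_range] at hlen
      have hn : n < decidedLength g (initSeg p k) := hlen
      have h1 := (List.prefix_iff_getElem?.1 hk) n (by rw [initSeg_length]; omega)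
      have h2 := (lt_decidedLength_iff.1 hn).2 n le_rfl
      obtain ⟨a, ha⟩ := Option.isSome_iff_exists.1 h2
      rw [List.getElem?_eq_getElem (by simpa [decidedWord] using hn)] at h1
      simp only [decidedWord, initSeg, List.getElem_map, List.getElem_range,
        Option.some.injEq] at h1
      have h5 : (g (initSeg p k) n).getD 0 = q n := h1
      rw [ha] at h5
      rw [ha, ← h5]
      rfl

/-- A computable function determines each finite part of its value from a finite part of its
argument. -/
theorem IsComputable.exists_modulus {F : Baire →. Baire} (hF : IsComputable F) {p q : Baire}
    (hq : q ∈ F p) (n : ℕ) :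
    ∃ k, ∀ p' q', (∀ i < k, p' i = p i) → q' ∈ F p' → ∀ i < n, q' i = q i := by
  obtain ⟨h, -, hmono, hspec⟩ := hF
  obtain ⟨k, hk⟩ := (hspec p q).1 hq n
  refine ⟨k, fun p' q' hp' hq' => ?_⟩
  obtain ⟨l, hl⟩ := (hspec p' q').1 hq' n
  have h1 : initSeg p' k = initSeg p k := initSeg_eq_iff.2 hp'
  rw [← h1] at hk
  have h2 := hk.trans (hmono _ _ (initSeg_prefix p' (le_max_left k l)))
  have h3 := hl.trans (hmono _ _ (initSeg_prefix p' (le_max_right k l)))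
  have h4 := (List.prefix_of_prefix_length_le h3 h2 (by simp [initSeg_length])).eq_of_length
    (by simp [initSeg_length])
  exact initSeg_eq_iff.1 h4


/-! ### Primitive recursive arithmetic on coded rationals -/

/-- Clearing denominators and moving negative terms across leaves a comparison in `ℕ`, which is
visibly primitive recursive. -/
theorem nuQ_lt_iff (x y : ℕ) : nuQ x < nuQ y ↔
    x.unpair.1.unpair.1 * (y.unpair.2 + 1) + y.unpair.1.unpair.2 * (x.unpair.2 + 1) <
      y.unpair.1.unpair.1 * (x.unpair.2 + 1) + x.unpair.1.unpair.2 * (y.unpair.2 + 1) := by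
  unfold nuQ
  rw [div_lt_div_iff₀ (by positivity) (by positivity), ← Nat.cast_lt (α := ℚ)]
  push_cast
  constructor <;> intro h <;> linarith

/-- A code of the sum of two rationals. -/
def addCode (x y : ℕ) : ℕ :=
  Nat.pair (Nat.pair
    (x.unpair.1.unpair.1 * (y.unpair.2 + 1) + y.unpair.1.unpair.1 * (x.unpair.2 + 1))
    (x.unpair.1.unpair.2 * (y.unpair.2 + 1) + y.unpair.1.unpair.2 * (x.unpair.2 + 1)))
    ((x.unpair.2 + 1) * (y.unpair.2 + 1) - 1)

theorem nuQ_addCode (x y : ℕ) : nuQ (addCode x y) = nuQ x + nuQ y := by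
  have h : (((x.unpair.2 + 1) * (y.unpair.2 + 1) - 1 : ℕ) : ℚ) + 1 =
      (x.unpair.2 + 1) * (y.unpair.2 + 1) := by
    exact_mod_cast Nat.sub_add_cancel (Nat.mul_pos (Nat.succ_pos _) (Nat.succ_pos _))
  simp only [addCode, nuQ, Nat.unpair_pair, h]
  push_cast
  field_simp
  ring

theorem primrec_unpair_fst : Primrec fun n : ℕ => n.unpair.1 := Primrec.fst.comp Primrec.unpair

theorem primrec_unpair_snd : Primrec fun n : ℕ => n.unpair.2 := Primrec.snd.comp Primrec.unpair

theorem primrec_nat_pow : Primrec₂ fun m n : ℕ => m ^ n :=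
  Primrec₂.unpaired'.1 Nat.Primrec.pow

theorem primrecRel_nuQ_lt : PrimrecRel fun x y : ℕ => nuQ x < nuQ y := by
  have hx1 := primrec_unpair_fst.comp (primrec_unpair_fst.comp (Primrec.fst (α := ℕ) (β := ℕ)))
  have hx2 := primrec_unpair_snd.comp (primrec_unpair_fst.comp (Primrec.fst (α := ℕ) (β := ℕ)))
  have hx3 := Primrec.succ.comp (primrec_unpair_snd.comp (Primrec.fst (α := ℕ) (β := ℕ)))
  have hy1 := primrec_unpair_fst.comp (primrec_unpair_fst.comp (Primrec.snd (α := ℕ) (β := ℕ)))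
  have hy2 := primrec_unpair_snd.comp (primrec_unpair_fst.comp (Primrec.snd (α := ℕ) (β := ℕ)))
  have hy3 := Primrec.succ.comp (primrec_unpair_snd.comp (Primrec.snd (α := ℕ) (β := ℕ)))
  refine PrimrecRel.of_eq ?_ fun x y => (nuQ_lt_iff x y).symm
  exact Primrec.nat_lt.comp
    (Primrec.nat_add.comp (Primrec.nat_mul.comp hx1 hy3) (Primrec.nat_mul.comp hy2 hx3))
    (Primrec.nat_add.comp (Primrec.nat_mul.comp hy1 hx3) (Primrec.nat_mul.comp hx2 hy3))

theorem primrec_addCode : Primrec₂ addCode := by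
  have hx1 := primrec_unpair_fst.comp (primrec_unpair_fst.comp (Primrec.fst (α := ℕ) (β := ℕ)))
  have hx2 := primrec_unpair_snd.comp (primrec_unpair_fst.comp (Primrec.fst (α := ℕ) (β := ℕ)))
  have hx3 := Primrec.succ.comp (primrec_unpair_snd.comp (Primrec.fst (α := ℕ) (β := ℕ)))
  have hy1 := primrec_unpair_fst.comp (primrec_unpair_fst.comp (Primrec.snd (α := ℕ) (β := ℕ)))
  have hy2 := primrec_unpair_snd.comp (primrec_unpair_fst.comp (Primrec.snd (α := ℕ) (β := ℕ)))
  have hy3 := Primrec.succ.comp (primrec_unpair_snd.comp (Primrec.snd (α := ℕ) (β := ℕ)))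
  exact Primrec₂.natPair.comp
    (Primrec₂.natPair.comp
      (Primrec.nat_add.comp (Primrec.nat_mul.comp hx1 hy3) (Primrec.nat_mul.comp hy1 hx3))
      (Primrec.nat_add.comp (Primrec.nat_mul.comp hx2 hy3) (Primrec.nat_mul.comp hy2 hx3)))
    (Primrec.nat_sub.comp (Primrec.nat_mul.comp hx3 hy3) (Primrec.const 1))

/-- The rational with code `x` belongs to the rational ball with code `e`. -/
def InBall (e x : ℕ) : Prop :=
  nuQ e.unpair.1 < nuQ (addCode x e.unpair.2) ∧ nuQ x < nuQ (addCode e.unpair.1 e.unpair.2)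

theorem inBall_iff (e x : ℕ) : InBall e x ↔ (nuQ x : ℝ) ∈ ratBall e := by
  rw [InBall, nuQ_addCode, nuQ_addCode, ratBall, Metric.mem_ball, Real.dist_eq, abs_lt,
    ← Rat.cast_lt (K := ℝ), ← Rat.cast_lt (K := ℝ)]
  push_cast
  constructor <;> rintro ⟨h1, h2⟩ <;> constructor <;> linarith

theorem primrecRel_inBall : PrimrecRel InBall := by
  have h1 := primrec_unpair_fst.comp (Primrec.fst (α := ℕ) (β := ℕ))
  have h2 := primrec_unpair_snd.comp (Primrec.fst (α := ℕ) (β := ℕ))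
  have hx := Primrec.snd (α := ℕ) (β := ℕ)
  exact (primrecRel_nuQ_lt.comp h1 (primrec_addCode.comp hx h2)).and
    (primrecRel_nuQ_lt.comp hx (primrec_addCode.comp h1 h2))

/-! ### Semi-deciding that a dyadic interval misses a closed set -/

/-- The integer with code `⟨i, j⟩` is `i - j`. -/
def codedInt (z : ℕ) : ℤ := (z.unpair.1 : ℤ) - z.unpair.2

/-- The closed dyadic interval `[z / 2 ^ m, (z + 1) / 2 ^ m]` with code `⟨m, z⟩`. -/
def dyadicIcc (m z : ℕ) : Set ℝ :=
  Set.Icc ((codedInt z : ℝ) / 2 ^ m) (((codedInt z : ℝ) + 1) / 2 ^ m)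

/-- A code of the `t`-th of the points that split the dyadic interval with code `c` into `s + 1`
equal parts. -/
def splitPoint (c s t : ℕ) : ℕ :=
  Nat.pair (Nat.pair (c.unpair.2.unpair.1 * (s + 1) + t) (c.unpair.2.unpair.2 * (s + 1)))
    (2 ^ c.unpair.1 * (s + 1) - 1)

theorem nuQ_splitPoint (m z s t : ℕ) : (nuQ (splitPoint (Nat.pair m z) s t) : ℝ) =
    (codedInt z + t / (s + 1)) / 2 ^ m := by
  have h : ((2 ^ m * (s + 1) - 1 : ℕ) : ℝ) + 1 = 2 ^ m * (s + 1) := by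
    exact_mod_cast Nat.sub_add_cancel (Nat.mul_pos (by positivity) (Nat.succ_pos _))
  simp only [splitPoint, nuQ, codedInt, Nat.unpair_pair]
  push_cast [h]
  field_simp
  ring

/-- Each of the `s + 1` equal parts of the dyadic interval with code `c` lies in one of the rational
balls with codes in `u`. -/
def Covers (u : List ℕ) (c s : ℕ) : Prop :=
  ∀ t < s + 1, ∃ e ∈ u, InBall e (splitPoint c s t) ∧ InBall e (splitPoint c s (t + 1))

theorem primrec_splitPoint : Primrec fun x : (ℕ × ℕ) × ℕ => splitPoint x.1.1 x.1.2 x.2 := by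
  have hc := Primrec.fst.comp (Primrec.fst (α := ℕ × ℕ) (β := ℕ))
  have hs := Primrec.succ.comp (Primrec.snd.comp (Primrec.fst (α := ℕ × ℕ) (β := ℕ)))
  have ht := Primrec.snd (α := ℕ × ℕ) (β := ℕ)
  have hz := primrec_unpair_snd.comp hc
  exact Primrec₂.natPair.comp
    (Primrec₂.natPair.comp
      (Primrec.nat_add.comp (Primrec.nat_mul.comp (primrec_unpair_fst.comp hz) hs) ht)
      (Primrec.nat_mul.comp (primrec_unpair_snd.comp hz) hs))
    (Primrec.nat_sub.comp
      (Primrec.nat_mul.comp (primrec_nat_pow.comp (Primrec.const 2) (primrec_unpair_fst.comp hc)) hs)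
      (Primrec.const 1))

theorem primrecRel_inBall_splitPoint : PrimrecRel fun (e : ℕ) (y : (ℕ × ℕ) × ℕ) =>
    InBall e (splitPoint y.1.1 y.1.2 y.2) ∧ InBall e (splitPoint y.1.1 y.1.2 (y.2 + 1)) := by
  have hy : Primrec fun x : ℕ × (ℕ × ℕ) × ℕ => (x.2.1, x.2.2 + 1) :=
    Primrec.pair (Primrec.fst.comp Primrec.snd)
      (Primrec.succ.comp (Primrec.snd.comp Primrec.snd))
  have hl : Primrec fun x : ℕ × (ℕ × ℕ) × ℕ => splitPoint x.2.1.1 x.2.1.2 x.2.2 :=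
    primrec_splitPoint.comp Primrec.snd
  have hr : Primrec fun x : ℕ × (ℕ × ℕ) × ℕ => splitPoint x.2.1.1 x.2.1.2 (x.2.2 + 1) :=
    primrec_splitPoint.comp hy
  exact PrimrecPred.and (primrecRel_inBall.comp Primrec.fst hl)
    (primrecRel_inBall.comp Primrec.fst hr)

theorem _root_.PrimrecRel.forall_lt_exists_mem {α : Type*} [Primcodable α]
    {R : ℕ → α × ℕ → Prop} (hR : PrimrecRel R) {n : α → ℕ} (hn : Primrec n) {u : α → List ℕ}
    (hu : Primrec u) : PrimrecPred fun x => ∀ t < n x, ∃ e ∈ u x, R e (x, t) := by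
  have h1 : PrimrecRel fun (t : ℕ) (x : α) => ∃ e ∈ u x, R e (x, t) :=
    hR.exists_mem_list.comp (hu.comp Primrec.snd) (Primrec.pair Primrec.snd Primrec.fst)
  exact (h1.forall_mem_list.comp (Primrec.list_range.comp hn) Primrec.id).of_eq
    fun x => by simp

theorem primrecPred_covers : PrimrecPred fun x : List ℕ × ℕ × ℕ => Covers x.1 x.2.1 x.2.2 := by
  have hn : Primrec fun x : List ℕ × ℕ × ℕ => x.2.2 + 1 :=
    Primrec.succ.comp (Primrec.snd.comp Primrec.snd)
  have hy : Primrec fun y : (List ℕ × ℕ × ℕ) × ℕ => (y.1.2, y.2) :=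
    Primrec.pair (Primrec.snd.comp Primrec.fst) Primrec.snd
  exact (primrecRel_inBall_splitPoint.comp₂ Primrec₂.left (hy.comp₂ Primrec₂.right)
    ).forall_lt_exists_mem hn Primrec.fst

theorem exists_mem_Icc_splitPoint {m z s : ℕ} {x : ℝ} (hx : x ∈ dyadicIcc m z) :
    ∃ t < s + 1, x ∈ Set.Icc (nuQ (splitPoint (Nat.pair m z) s t) : ℝ)
      (nuQ (splitPoint (Nat.pair m z) s (t + 1))) := by
  have h2 : (0 : ℝ) < 2 ^ m := by positivity
  have hs : (0 : ℝ) < s + 1 := by positivity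
  obtain ⟨hx1, hx2⟩ := hx
  rw [div_le_iff₀ h2] at hx1
  rw [le_div_iff₀ h2] at hx2
  have hpos : 0 ≤ (x * 2 ^ m - codedInt z) * (s + 1) := mul_nonneg (by linarith) hs.le
  have hle : (x * 2 ^ m - codedInt z) * (s + 1) ≤ s + 1 := by nlinarith
  by_cases hend : (x * 2 ^ m - codedInt z) * (s + 1) < s + 1
  · refine ⟨⌊(x * 2 ^ m - codedInt z) * (s + 1)⌋₊, ?_, ?_⟩
    · rw [Nat.floor_lt hpos]
      exact_mod_cast hend
    · rw [nuQ_splitPoint, nuQ_splitPoint, Set.mem_Icc, div_le_iff₀ h2, le_div_iff₀ h2]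
      have h3 := (div_le_iff₀ hs).2 (Nat.floor_le hpos)
      have h4 := (lt_div_iff₀ hs).2 (Nat.lt_floor_add_one ((x * 2 ^ m - codedInt z) * (s + 1)))
      push_cast
      constructor <;> linarith
  -- At the right endpoint of the interval the floor would be `s + 1`, so the last part `s` is taken
  -- instead.
  · have heq : x * 2 ^ m - codedInt z = 1 := by
      have := le_antisymm hle (not_lt.1 hend)
      exact mul_right_cancel₀ hs.ne' (by rw [this, one_mul])
    refine ⟨s, Nat.lt_succ_self s, ?_⟩
    rw [nuQ_splitPoint, nuQ_splitPoint, Set.mem_Icc, div_le_iff₀ h2, le_div_iff₀ h2]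
    have h3 : (s : ℝ) / (s + 1) ≤ 1 := (div_le_one hs).2 (by linarith)
    push_cast
    rw [div_self hs.ne']
    constructor <;> linarith

/-- A ball is convex, so it contains each part whose two endpoints it contains. -/
theorem Covers.subset {u : List ℕ} {m z s : ℕ} (h : Covers u (Nat.pair m z) s) {x : ℝ}
    (hx : x ∈ dyadicIcc m z) : ∃ e ∈ u, x ∈ ratBall e := by
  obtain ⟨t, ht, hxt⟩ := exists_mem_Icc_splitPoint (s := s) hx
  obtain ⟨e, he, h1, h2⟩ := h t ht
  rw [inBall_iff] at h1 h2
  refine ⟨e, he, ?_⟩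
  have hconv : (ratBall e).OrdConnected := (convex_ball _ _).ordConnected
  exact hconv.out h1 h2 hxt

theorem splitPoint_mem {m z s t : ℕ} (ht : t ≤ s + 1) :
    (nuQ (splitPoint (Nat.pair m z) s t) : ℝ) ∈ dyadicIcc m z := by
  have h2 : (0 : ℝ) < 2 ^ m := by positivity
  have hs : (0 : ℝ) < s + 1 := by positivity
  have h1 : (t : ℝ) / (s + 1) ≤ 1 := (div_le_one hs).2 (by exact_mod_cast ht)
  have h0 : 0 ≤ (t : ℝ) / (s + 1) := by positivity
  rw [nuQ_splitPoint]
  constructor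
  · gcongr
    linarith
  · gcongr

/-- Take a finite subcover and a Lebesgue number `δ` for it: parts shorter than `δ` fit into a
single ball of the subcover. -/
theorem exists_covers {p : Baire} {m z : ℕ} (h : dyadicIcc m z ⊆ ⋃ i, ratBall (p i)) :
    ∃ s, Covers (initSeg p s) (Nat.pair m z) s := by
  have hI : IsCompact (dyadicIcc m z) := isCompact_Icc
  have hopen : ∀ i, IsOpen (ratBall (p i)) := fun i => Metric.isOpen_ball
  obtain ⟨T, hT⟩ := hI.elim_finite_subcover _ hopen h
  obtain ⟨δ, hδ, hleb⟩ := lebesgue_number_lemma_of_metric (c := fun i : T => ratBall (p i)) hI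
    (fun i => hopen i) (by
      intro x hx
      obtain ⟨i, hi, hxi⟩ := Set.mem_iUnion₂.1 (hT hx)
      exact Set.mem_iUnion.2 ⟨⟨i, hi⟩, hxi⟩)
  obtain ⟨n, hn⟩ := exists_nat_one_div_lt hδ
  -- One `s` bounds both the prefix and the number of parts: it exceeds all indices of the subcover
  -- and makes the parts shorter than `δ`.
  refine ⟨max n (T.sup id + 1), fun t ht => ?_⟩
  set s := max n (T.sup id + 1) with hs
  obtain ⟨⟨i, hi⟩, hball⟩ := hleb _ (splitPoint_mem (z := z) (m := m) ht.le)
  have his : i < s := lt_of_lt_of_le (Nat.lt_succ_of_le (Finset.le_sup (f := id) hi))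
    (le_max_right _ _)
  refine ⟨p i, List.mem_map.2 ⟨i, List.mem_range.2 his, rfl⟩, ?_, ?_⟩
  · exact (inBall_iff _ _).2 (hball (Metric.mem_ball_self hδ))
  · refine (inBall_iff _ _).2 (hball ?_)
    rw [Metric.mem_ball, Real.dist_eq, nuQ_splitPoint, nuQ_splitPoint]
    have h1 : ((codedInt z : ℝ) + (t + 1 : ℕ) / (s + 1)) / 2 ^ m -
        (codedInt z + t / (s + 1)) / 2 ^ m = 1 / (s + 1) / 2 ^ m := by
      push_cast
      ring
    rw [h1, abs_of_nonneg (by positivity)]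
    calc (1 : ℝ) / (s + 1) / 2 ^ m ≤ 1 / (s + 1) :=
          div_le_self (by positivity) (one_le_pow₀ (by norm_num))
      _ ≤ 1 / (n + 1) := by
          have : (n : ℝ) ≤ s := by exact_mod_cast le_max_left _ _
          gcongr
      _ < δ := hn

theorem exists_covers_iff {p : Baire} {A : TopologicalSpace.Closeds ℝ} (hp : closedRep.Names p A)
    {m z : ℕ} : (∃ s, Covers (initSeg p s) (Nat.pair m z) s) ↔ ¬ (dyadicIcc m z ∩ A).Nonempty := by
  have hpA : (A : Set ℝ)ᶜ = ⋃ i, ratBall (p i) := hp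
  constructor
  · rintro ⟨s, hs⟩ ⟨x, hx, hxA⟩
    obtain ⟨e, he, hxe⟩ := hs.subset hx
    obtain ⟨i, -, rfl⟩ := List.mem_map.1 he
    have : x ∈ (A : Set ℝ)ᶜ := hpA ▸ Set.mem_iUnion.2 ⟨i, hxe⟩
    exact this hxA
  · intro h
    refine exists_covers (hpA ▸ fun x hx hxA => h ⟨x, hx, hxA⟩)

open Classical in
/-- The word function that asks for each dyadic interval whether it avoids the closed set named
by the argument. -/
noncomputable def askWord (u : List ℕ) (n : ℕ) : Option ℕ :=
  if n.unpair.2 ≤ u.length then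
    some (if Covers (u.take n.unpair.2) n.unpair.1 n.unpair.2 then 0 else 1)
  else none

theorem primrec_askWord : Primrec₂ askWord := by
  classical
  have hu := Primrec.fst (α := List ℕ) (β := ℕ)
  have hc := primrec_unpair_fst.comp (Primrec.snd (α := List ℕ) (β := ℕ))
  have hs := primrec_unpair_snd.comp (Primrec.snd (α := List ℕ) (β := ℕ))
  exact Primrec.ite (Primrec.nat_le.comp hs (Primrec.list_length.comp hu))
    (Primrec.option_some.comp (Primrec.ite
      (primrecPred_covers.comp (Primrec.pair (Primrec.list_take.comp hs hu) (Primrec.pair hc hs)))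
      (Primrec.const 0) (Primrec.const 1)))
    (Primrec.const none)

/-- The value at `⟨c, s⟩` waits for `s` input symbols and then uses only these. -/
theorem prefixMonotone_askWord : PrefixMonotone askWord := by
  rintro u v ⟨w, rfl⟩ n a h
  unfold askWord at h ⊢
  split_ifs at h with h1
  all_goals
    rw [if_pos (h1.trans (by simp)), List.take_append_of_le_length h1]
    simp_all

open Classical in
/-- The instance of `C` that asks for each dyadic interval whether it avoids the closed set named
by `p`. -/
noncomputable def askSeq (p : Baire) : Baire := fun n =>
  if Covers (initSeg p n.unpair.2) n.unpair.1 n.unpair.2 then 0 else 1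

theorem askSeq_mem (p : Baire) : askSeq p ∈ approxFun askWord p := by
  rw [mem_approxFun prefixMonotone_askWord]
  intro n
  refine ⟨n.unpair.2, ?_⟩
  rw [askWord, if_pos (initSeg_length p _).ge, initSeg_take p le_rfl]
  rfl


/-! ### Bisection guided by the answers -/

/-- The answer to the `c`-th instance of `LPO`, read off from a prefix of `⟨p, q⟩`. -/
def answer (u : List ℕ) (c : ℕ) : Option ℕ := u[2 * Nat.pair c 0 + 1]?

theorem answer_mono {u v : List ℕ} (h : u <+: v) {c a : ℕ} (ha : answer u c = some a) :
    answer v c = some a := by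
  obtain ⟨w, rfl⟩ := h
  unfold answer at ha ⊢
  rw [List.getElem?_append_left (List.getElem?_eq_some_iff.1 ha).1, ha]

theorem lt_length_of_answer {u : List ℕ} {c a : ℕ} (ha : answer u c = some a) : c < u.length := by
  have h := (List.getElem?_eq_some_iff.1 ha).1
  have := Nat.left_le_pair c 0
  omega

theorem answer_initSeg_pair (p q : Baire) (c : ℕ) {k : ℕ} (hk : 2 * Nat.pair c 0 + 1 < k) :
    answer (initSeg (pair p q) k) c = some (q (Nat.pair c 0)) := by
  rw [answer, initSeg_getElem? _ hk]
  have h1 : (2 * Nat.pair c 0 + 1) % 2 = 1 := by omega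
  have h2 : (2 * Nat.pair c 0 + 1) / 2 = Nat.pair c 0 := by omega
  simp [pair, h1, h2]

theorem primrec_answer : Primrec₂ answer :=
  Primrec.list_getElem?.comp Primrec.fst (Primrec.succ.comp (Primrec.nat_mul.comp (Primrec.const 2)
    (Primrec₂.natPair.comp Primrec.snd (Primrec.const 0))))

/-- The first interval of length one that receives a positive answer. -/
def firstHit (u : List ℕ) : Option ℕ :=
  let z := (List.range u.length).findIdx fun z => decide (answer u (Nat.pair 0 z) ≠ some 0)
  (answer u (Nat.pair 0 z)).map fun _ => z

theorem primrec_firstHit : Primrec firstHit := by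
  have h1 : Primrec₂ fun (u : List ℕ) (z : ℕ) => answer u (Nat.pair 0 z) :=
    primrec_answer.comp₂ Primrec₂.left (Primrec₂.natPair.comp₂ (Primrec₂.const 0) Primrec₂.right)
  have h2 : Primrec₂ fun (u : List ℕ) (z : ℕ) => decide (answer u (Nat.pair 0 z) ≠ some 0) :=
    PrimrecPred.decide (PrimrecPred.not (Primrec.eq.comp h1 (Primrec.const (some 0))))
  have h3 := Primrec.list_findIdx (Primrec.list_range.comp Primrec.list_length) h2
  exact Primrec.option_map (h1.comp Primrec.id h3) (h3.comp Primrec.fst)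

/-- The search also stops at a missing answer, but then nothing is returned. So a hit is final: all
earlier unit intervals have been answered with `0`. The search bound `u.length` loses nothing, as
any available answer has a smaller index. -/
theorem firstHit_eq_some_iff {u : List ℕ} {z : ℕ} : firstHit u = some z ↔
    (∀ y < z, answer u (Nat.pair 0 y) = some 0) ∧ ∃ a ≠ 0, answer u (Nat.pair 0 z) = some a := by
  unfold firstHit
  constructor
  · intro h
    obtain ⟨a, ha, hz⟩ := Option.map_eq_some_iff.1 h
    rw [hz] at ha
    have hlt : z < u.length :=
      (Nat.right_le_pair 0 z).trans_lt (lt_length_of_answer ha)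
    have h1 := (List.findIdx_eq (by simpa using hlt)).1 hz
    simp only [List.getElem_range, decide_eq_true_eq, decide_eq_false_iff_not, not_not] at h1
    exact ⟨fun y hy => h1.2 y hy, a, fun h0 => h1.1 (h0 ▸ ha), ha⟩
  · rintro ⟨h0, a, ha0, ha⟩
    have hlt : z < u.length :=
      (Nat.right_le_pair 0 z).trans_lt (lt_length_of_answer ha)
    have hz : (List.range u.length).findIdx
        (fun z => decide (answer u (Nat.pair 0 z) ≠ some 0)) = z := by
      rw [List.findIdx_eq (by simpa using hlt)]
      simp only [List.getElem_range, decide_eq_true_eq, decide_eq_false_iff_not, not_not]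
      exact ⟨by simpa [ha] using ha0, fun y hy => h0 y hy⟩
    simp only [hz, ha, Option.map_some]

/-- A code of the double of the integer with code `z`. -/
def dbl (z : ℕ) : ℕ := Nat.pair (2 * z.unpair.1) (2 * z.unpair.2)

/-- A code of one more than the double of the integer with code `z`. -/
def dblSucc (z : ℕ) : ℕ := Nat.pair (2 * z.unpair.1 + 1) (2 * z.unpair.2)

theorem codedInt_dbl (z : ℕ) : codedInt (dbl z) = 2 * codedInt z := by
  simp [codedInt, dbl, mul_sub]

theorem codedInt_dblSucc (z : ℕ) : codedInt (dblSucc z) = 2 * codedInt z + 1 := by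
  simp [codedInt, dblSucc]
  ring

theorem primrec_dbl : Primrec dbl :=
  Primrec₂.natPair.comp (Primrec.nat_mul.comp (Primrec.const 2) primrec_unpair_fst)
    (Primrec.nat_mul.comp (Primrec.const 2) primrec_unpair_snd)

theorem primrec_dblSucc : Primrec dblSucc :=
  Primrec₂.natPair.comp
    (Primrec.succ.comp (Primrec.nat_mul.comp (Primrec.const 2) primrec_unpair_fst))
    (Primrec.nat_mul.comp (Primrec.const 2) primrec_unpair_snd)

/-- One bisection step: pass from an interval of level `m` to its left half if that receives a
positive answer, and to its right half otherwise. -/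
def bisectStep (u : List ℕ) (m z : ℕ) : Option ℕ :=
  (answer u (Nat.pair (m + 1) (dbl z))).map fun b => if b = 0 then dblSucc z else dbl z

/-- The interval of level `n` found by bisection. -/
def bisect (u : List ℕ) : ℕ → Option ℕ
  | 0 => firstHit u
  | m + 1 => (bisect u m).bind (bisectStep u m)

theorem primrec_bisectStep : Primrec fun x : List ℕ × ℕ × ℕ => bisectStep x.1 x.2.1 x.2.2 := by
  have hz : Primrec fun x : List ℕ × ℕ × ℕ => x.2.2 := Primrec.snd.comp Primrec.snd
  have h1 : Primrec fun x : List ℕ × ℕ × ℕ => answer x.1 (Nat.pair (x.2.1 + 1) (dbl x.2.2)) :=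
    primrec_answer.comp Primrec.fst (Primrec₂.natPair.comp
      (Primrec.succ.comp (Primrec.fst.comp Primrec.snd)) (primrec_dbl.comp hz))
  refine Primrec.option_map h1 ?_
  exact Primrec.ite (Primrec.eq.comp Primrec.snd (Primrec.const 0))
    (primrec_dblSucc.comp (hz.comp Primrec.fst)) (primrec_dbl.comp (hz.comp Primrec.fst))

theorem primrec_bisect : Primrec₂ bisect := by
  have hstep : Primrec₂ fun (u : List ℕ) (x : ℕ × Option ℕ) => x.2.bind (bisectStep u x.1) := by
    refine Primrec.option_bind (Primrec.snd.comp Primrec.snd) ?_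
    have : Primrec fun y : (List ℕ × ℕ × Option ℕ) × ℕ => (y.1.1, y.1.2.1, y.2) :=
      Primrec.pair (Primrec.fst.comp Primrec.fst)
        (Primrec.pair (Primrec.fst.comp (Primrec.snd.comp Primrec.fst)) Primrec.snd)
    exact primrec_bisectStep.comp this
  refine (Primrec.nat_rec primrec_firstHit hstep).of_eq fun u n => ?_
  induction n with
  | zero => rfl
  | succ n ih =>
    change Option.bind _ _ = Option.bind _ _
    rw [ih]

theorem bisect_mono {u v : List ℕ} (h : u <+: v) : ∀ {n z : ℕ}, bisect u n = some z →
    bisect v n = some z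
  | 0, z, hz => by
    obtain ⟨h0, a, ha0, ha⟩ := firstHit_eq_some_iff.1 hz
    exact firstHit_eq_some_iff.2
      ⟨fun y hy => answer_mono h (h0 y hy), a, ha0, answer_mono h ha⟩
  | n + 1, z, hz => by
    obtain ⟨y, hy, hyz⟩ := Option.bind_eq_some_iff.1 hz
    obtain ⟨b, hb, hbz⟩ := Option.map_eq_some_iff.1 hyz
    refine Option.bind_eq_some_iff.2 ⟨y, bisect_mono h hy, ?_⟩
    exact Option.map_eq_some_iff.2 ⟨b, answer_mono h hb, hbz⟩

/-- A code of the left endpoint of the interval with code `⟨n, z⟩`. -/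
def leftCode (n z : ℕ) : ℕ := Nat.pair z (2 ^ n - 1)

theorem nuQ_leftCode (n z : ℕ) : nuQ (leftCode n z) = codedInt z / 2 ^ n := by
  simp [nuQ, leftCode, codedInt]

/-- The word function that outputs the left endpoints of the intervals found by bisection. -/
def bisectWord (u : List ℕ) (n : ℕ) : Option ℕ := (bisect u n).map (leftCode n)

theorem primrec_bisectWord : Primrec₂ bisectWord := by
  refine Primrec.option_map primrec_bisect ?_
  exact Primrec₂.natPair.comp Primrec.snd (Primrec.nat_sub.comp
    (primrec_nat_pow.comp (Primrec.const 2) (Primrec.snd.comp Primrec.fst)) (Primrec.const 1))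

theorem prefixMonotone_bisectWord : PrefixMonotone bisectWord := by
  intro u v huv n a h
  obtain ⟨z, hz, rfl⟩ := Option.map_eq_some_iff.1 h
  exact Option.map_eq_some_iff.2 ⟨z, bisect_mono huv hz, rfl⟩

theorem dyadicIcc_subset_union (m z : ℕ) :
    dyadicIcc m z ⊆ dyadicIcc (m + 1) (dbl z) ∪ dyadicIcc (m + 1) (dblSucc z) := by
  rintro x ⟨h1, h2⟩
  have hm : (0 : ℝ) < 2 ^ m := by positivity
  rw [div_le_iff₀ hm] at h1
  rw [le_div_iff₀ hm] at h2
  rcases le_total (x * 2 ^ (m + 1)) (2 * codedInt z + 1) with h | h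
  · left
    rw [dyadicIcc, codedInt_dbl, Set.mem_Icc, div_le_iff₀ (by positivity),
      le_div_iff₀ (by positivity)]
    push_cast
    rw [pow_succ] at h ⊢
    constructor <;> linarith
  · right
    rw [dyadicIcc, codedInt_dblSucc, Set.mem_Icc, div_le_iff₀ (by positivity),
      le_div_iff₀ (by positivity)]
    push_cast
    rw [pow_succ] at h ⊢
    constructor <;> linarith

theorem exists_mem_dyadicIcc_zero (x : ℝ) : ∃ z, x ∈ dyadicIcc 0 z := by
  refine ⟨Nat.pair ⌊x⌋.toNat (-⌊x⌋).toNat, ?_⟩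
  have h : codedInt (Nat.pair ⌊x⌋.toNat (-⌊x⌋).toNat) = ⌊x⌋ := by
    simp only [codedInt, Nat.unpair_pair]
    omega
  rw [dyadicIcc, h]
  simp [Int.floor_le, (Int.lt_floor_add_one x).le]

/-- The invariant is that the current interval meets `A`. It suffices to query the left half: if
that misses `A`, the right half meets it. -/
theorem exists_bisect {A : Set ℝ} (hA : A.Nonempty) {p q : Baire}
    (hq : ∀ m z, q (Nat.pair (Nat.pair m z) 0) = 0 ↔ ¬ (dyadicIcc m z ∩ A).Nonempty) (n : ℕ) :
    ∃ z k, bisect (initSeg (pair p q) k) n = some z ∧ (dyadicIcc n z ∩ A).Nonempty := by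
  classical
  induction n with
  | zero =>
    have hex : ∃ z, q (Nat.pair (Nat.pair 0 z) 0) ≠ 0 := by
      obtain ⟨x, hx⟩ := hA
      obtain ⟨z, hz⟩ := exists_mem_dyadicIcc_zero x
      exact ⟨z, fun h => (hq 0 z).1 h ⟨x, hz, hx⟩⟩
    refine ⟨Nat.find hex, 2 * Nat.pair (Nat.pair 0 (Nat.find hex)) 0 + 2, ?_, ?_⟩
    · refine firstHit_eq_some_iff.2 ⟨fun y hy => ?_, _, Nat.find_spec hex,
        answer_initSeg_pair _ _ _ (Nat.lt_succ_self _)⟩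
      rw [answer_initSeg_pair, not_not.1 (Nat.find_min hex hy)]
      have := Nat.pair_lt_pair_left 0 (Nat.pair_lt_pair_right 0 hy)
      omega
    · exact not_not.1 (mt (hq _ _).2 (Nat.find_spec hex))
  | succ n ih =>
    obtain ⟨z, k, hk, hz⟩ := ih
    have hb := answer_initSeg_pair p q (Nat.pair (n + 1) (dbl z))
      (le_max_right k (2 * Nat.pair (Nat.pair (n + 1) (dbl z)) 0 + 2))
    have hk' := bisect_mono (initSeg_prefix (pair p q)
      (le_max_left k (2 * Nat.pair (Nat.pair (n + 1) (dbl z)) 0 + 2))) hk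
    refine ⟨if q (Nat.pair (Nat.pair (n + 1) (dbl z)) 0) = 0 then dblSucc z else dbl z, _,
      Option.bind_eq_some_iff.2 ⟨z, hk', Option.map_eq_some_iff.2 ⟨_, hb, rfl⟩⟩, ?_⟩
    split_ifs with h
    · obtain ⟨x, hx, hxA⟩ := hz
      rcases dyadicIcc_subset_union n z hx with h1 | h1
      · exact absurd ⟨x, h1, hxA⟩ ((hq _ _).1 h)
      · exact ⟨x, h1, hxA⟩
    · exact not_not.1 (mt (hq _ _).2 h)

theorem bisect_succ_bounds {u : List ℕ} {n z y : ℕ} (hz : bisect u n = some z)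
    (hy : bisect u (n + 1) = some y) :
    2 * codedInt z ≤ codedInt y ∧ codedInt y ≤ 2 * codedInt z + 1 := by
  obtain ⟨z', hz', hzy⟩ := Option.bind_eq_some_iff.1 hy
  obtain rfl : z' = z := Option.some.inj (hz'.symm.trans hz)
  obtain ⟨b, -, rfl⟩ := Option.map_eq_some_iff.1 hzy
  split_ifs
  · rw [codedInt_dblSucc]
    omega
  · rw [codedInt_dbl]
    omega

/-- Left endpoints increase and right endpoints decrease, which gives the Cauchy rate. The points of
`A` in the intervals are squeezed to the same limit, and `A` is closed. -/
theorem exists_realRep_of_dyadic {A : Set ℝ} (hA : IsClosed A) {z : ℕ → ℕ}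
    (hmeet : ∀ n, (dyadicIcc n (z n) ∩ A).Nonempty)
    (hz : ∀ n, 2 * codedInt (z n) ≤ codedInt (z (n + 1)) ∧
      codedInt (z (n + 1)) ≤ 2 * codedInt (z n) + 1) :
    ∃ x ∈ A, realRep.Names (fun n => leftCode n (z n)) x := by
  have hstep : ∀ n, nuQ (leftCode n (z n)) ≤ nuQ (leftCode (n + 1) (z (n + 1))) ∧
      nuQ (leftCode (n + 1) (z (n + 1))) + (1 / 2) ^ (n + 1) ≤
        nuQ (leftCode n (z n)) + (1 / 2) ^ n := by
    intro n
    obtain ⟨h1, h2⟩ := hz n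
    have h1' : 2 * (codedInt (z n) : ℚ) ≤ codedInt (z (n + 1)) := by exact_mod_cast h1
    have h2' : (codedInt (z (n + 1)) : ℚ) ≤ 2 * codedInt (z n) + 1 := by exact_mod_cast h2
    have hpos : (0 : ℚ) < 2 ^ n := by positivity
    rw [nuQ_leftCode, nuQ_leftCode, one_div, inv_pow, inv_pow, pow_succ]
    constructor
    · rw [div_le_div_iff₀ hpos (by positivity)]
      nlinarith
    · field_simp
      linarith
  have hmono : Monotone fun n => nuQ (leftCode n (z n)) := monotone_nat_of_le_succ fun n => (hstep n).1
  have hanti : Antitone fun n => nuQ (leftCode n (z n)) + (1 / 2) ^ n :=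
    antitone_nat_of_succ_le fun n => (hstep n).2
  have hdist : ∀ i k : ℕ, i < k →
      |nuQ (leftCode i (z i)) - nuQ (leftCode k (z k))| ≤ (1 / 2 : ℚ) ^ i := by
    intro i k hik
    have h1 := hmono hik.le
    have h2 := hanti hik.le
    have h3 : (0 : ℚ) < (1 / 2) ^ k := by positivity
    simp only at h1 h2
    rw [abs_le]
    constructor <;> linarith
  have hpow : Filter.Tendsto (fun n : ℕ => (1 / 2 : ℝ) ^ n) Filter.atTop (nhds 0) :=
    tendsto_pow_atTop_nhds_zero_of_lt_one (by norm_num) (by norm_num)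
  have hcauchy : CauchySeq fun n => (nuQ (leftCode n (z n)) : ℝ) := by
    refine cauchySeq_of_le_tendsto_0' (fun n : ℕ => (1 / 2 : ℝ) ^ n) (fun i k hik => ?_) hpow
    rcases hik.eq_or_lt with rfl | hik
    · simp
    · rw [Real.dist_eq]
      have := (Rat.cast_le (K := ℝ)).2 (hdist i k hik)
      push_cast at this
      exact this
  obtain ⟨x, hx⟩ := cauchySeq_tendsto_of_complete hcauchy
  refine ⟨x, ?_, hdist, hx⟩
  choose y hy hyA using hmeet
  refine hA.mem_of_tendsto (b := Filter.atTop) (f := y) ?_ (Filter.Eventually.of_forall hyA)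
  have hx' := hx.add hpow
  rw [add_zero] at hx'
  refine tendsto_of_tendsto_of_tendsto_of_le_of_le hx hx' (fun n => ?_) fun n => ?_
  · have := (hy n).1
    simp only [nuQ_leftCode]
    push_cast
    exact this
  · have := (hy n).2
    simp only [nuQ_leftCode]
    push_cast
    rwa [one_div, inv_pow, ← one_div, ← add_div]

theorem LPO_eq_zero_iff {r : Baire} {n : ℕ} (h : n ∈ LPO.toFun r) : n = 0 ↔ ∃ i, r i = 0 := by
  classical
  have h : n = if ∃ i, r i = 0 then 0 else 1 := by simpa [LPO] using h
  rw [h]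
  split_ifs with h1 <;> simp [h1]

theorem C_names (r : Baire) : C.dom.Names r fun i j => r (Nat.pair i j) := fun _ => rfl

theorem C_nonempty (x : ℕ → Baire) : (C.toFun x).Nonempty := by
  classical
  exact ⟨fun i => if ∃ n, x i n = 0 then 0 else 1, fun i => rfl⟩

/-- Any realizer of `C` yields answers to all the instances of `LPO`. -/
theorem exists_mem_of_realizes_C {G : Baire →. Baire} (hG : G ∈ C.realizers) (r : Baire) :
    ∃ q ∈ G r, ∀ i j, q (Nat.pair i j) = 0 ↔ ∃ k, r (Nat.pair i k) = 0 := by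
  obtain ⟨q, hq, y, hy, hqy⟩ := hG r _ (C_names r) (C_nonempty _)
  refine ⟨q, hq, fun i j => ?_⟩
  have h1 : (fun j => q (Nat.pair i j)) = fun _ => y i := hqy i
  rw [show q (Nat.pair i j) = y i from congrFun h1 j]
  exact LPO_eq_zero_iff (hy i)

theorem closedChoice_reducible_C : Reducible closedChoice C := by
  refine ⟨approxFun bisectWord, approxFun askWord,
    isComputable_approxFun primrec_bisectWord prefixMonotone_bisectWord,
    isComputable_approxFun primrec_askWord prefixMonotone_askWord, fun G hG => ⟨_, ?_, rfl⟩⟩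
  intro p A hp hA
  obtain ⟨q, hq, hqG⟩ := exists_mem_of_realizes_C hG (askSeq p)
  have hans : ∀ m z, q (Nat.pair (Nat.pair m z) 0) = 0 ↔ ¬ (dyadicIcc m z ∩ A).Nonempty := by
    intro m z
    rw [hqG, ← exists_covers_iff hp]
    simp [askSeq]
  choose z k hzk hmeet using exists_bisect (p := p) (A := A) hA hans
  -- The `z n` were chosen at unrelated stages; passing to a common longer prefix shows that
  -- consecutive ones belong to the same bisection.
  obtain ⟨x, hxA, hx⟩ := exists_realRep_of_dyadic (A.isClosed) hmeet fun n =>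
    bisect_succ_bounds
      (bisect_mono (initSeg_prefix (pair p q) (le_max_left (k n) (k (n + 1)))) (hzk n))
      (bisect_mono (initSeg_prefix (pair p q) (le_max_right (k n) (k (n + 1)))) (hzk (n + 1)))
  refine ⟨fun n => leftCode n (z n), ?_, x, hxA, hx⟩
  refine Part.mem_bind_iff.2 ⟨_, askSeq_mem p, Part.mem_bind_iff.2 ⟨q, hq, ?_⟩⟩
  rw [mem_approxFun prefixMonotone_bisectWord]
  exact fun n => ⟨k n, Option.map_eq_some_iff.2 ⟨z n, hzk n, rfl⟩⟩


/-! ### Irreducibility of `C` to closed choice -/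

/-- The closed set named by `p`. -/
def closedOf (p : Baire) : TopologicalSpace.Closeds ℝ :=
  ⟨(⋃ i, ratBall (p i))ᶜ, (isOpen_iUnion fun _ => Metric.isOpen_ball).isClosed_compl⟩

theorem mem_closedOf {p : Baire} {y : ℝ} : y ∈ closedOf p ↔ ∀ i, y ∉ ratBall (p i) := by
  change y ∈ (⋃ i, ratBall (p i))ᶜ ↔ _
  simp

theorem closedOf_names (p : Baire) : closedRep.Names p (closedOf p) := compl_compl _

/-- A realizer of closed choice can be redefined at a single place. -/
theorem exists_closedChoice_realizer (p : Baire) (v : Part Baire)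
    (hv : (closedOf p : Set ℝ).Nonempty → ∃ q ∈ v, ∃ y ∈ closedOf p, realRep.Names q y) :
    ∃ G ∈ closedChoice.realizers, G p = v := by
  classical
  refine ⟨fun p' => if p' = p then v else
    ⟨∃ q, ∃ y ∈ closedOf p', realRep.Names q y, fun h => h.choose⟩, ?_, if_pos rfl⟩
  intro p' A hA hne
  obtain rfl : A = closedOf p' := closedRep.unique hA (closedOf_names p')
  by_cases hp : p' = p
  · subst hp
    beta_reduce
    rw [if_pos rfl]
    exact hv hne
  · beta_reduce
    rw [if_neg hp]
    have h : ∃ q, ∃ y ∈ closedOf p', realRep.Names q y := by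
      obtain ⟨y, hy⟩ := hne
      obtain ⟨q, hq⟩ := realRep.surj y
      exact ⟨q, y, hy, hq⟩
    exact ⟨h.choose, ⟨h, rfl⟩, h.choose_spec⟩

/-- The strict bound is an open condition on `x`, so a finite part of such a name also begins a name
of every sufficiently close real. -/
theorem realRep_names_of_abs_lt {p : Baire} {x : ℝ}
    (hp : ∀ i, |(nuQ (p i) : ℝ) - x| < (1 / 2) ^ (i + 1)) : realRep.Names p x := by
  constructor
  · intro i k hik
    have hpow : (1 / 2 : ℝ) ^ (k + 1) ≤ (1 / 2) ^ (i + 1) :=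
      pow_le_pow_of_le_one (by norm_num) (by norm_num) (by omega)
    have hi := abs_lt.1 (hp i)
    have hk := abs_lt.1 (hp k)
    have hsucc : (1 / 2 : ℝ) ^ (i + 1) = (1 / 2) ^ i / 2 := by ring
    rw [← Rat.cast_le (K := ℝ)]
    push_cast
    rw [abs_le]
    constructor <;> linarith [hi.1, hi.2, hk.1, hk.2]
  · rw [tendsto_iff_dist_tendsto_zero]
    refine squeeze_zero (fun _ => dist_nonneg) (fun i => ?_)
      (tendsto_pow_atTop_nhds_zero_of_lt_one (r := (1 / 2 : ℝ)) (by norm_num) (by norm_num))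
    rw [Real.dist_eq]
    exact (hp i).le.trans (pow_le_pow_of_le_one (by norm_num) (by norm_num) (Nat.le_succ i))

theorem exists_abs_nuQ_sub_lt (x : ℝ) :
    ∃ p : Baire, ∀ i, |(nuQ (p i) : ℝ) - x| < (1 / 2) ^ (i + 1) := by
  have h : ∀ i : ℕ, ∃ n : ℕ, |(nuQ n : ℝ) - x| < (1 / 2 : ℝ) ^ (i + 1) := by
    intro i
    obtain ⟨q, hq⟩ := Rat.denseRange_cast.exists_dist_lt x
      (show (0 : ℝ) < (1 / 2) ^ (i + 1) by positivity)
    obtain ⟨n, rfl⟩ := nuQ_surjective q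
    exact ⟨n, by rwa [dist_comm, Real.dist_eq] at hq⟩
  choose p hp using h
  exact ⟨p, hp⟩

theorem exists_cylinder_subset {U : Set Baire} (hU : IsOpen U) {x : Baire} (hx : x ∈ U) :
    ∃ n, ∀ y : Baire, (∀ i < n, y i = x i) → y ∈ U := by
  obtain ⟨t, ⟨y, n, rfl⟩, hxt, ht⟩ :=
    (PiNat.isTopologicalBasis_cylinders fun _ : ℕ => ℕ).isOpen_iff.1 hU x hx
  exact ⟨n, fun z hz => ht fun i hi => (hz i hi).trans (hxt i hi)⟩

theorem isOpen_of_cylinder_subset {U : Set Baire}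
    (h : ∀ x ∈ U, ∃ n, ∀ y : Baire, (∀ i < n, y i = x i) → y ∈ U) : IsOpen U := by
  rw [(PiNat.isTopologicalBasis_cylinders fun _ : ℕ => ℕ).isOpen_iff]
  intro x hx
  obtain ⟨n, hn⟩ := h x hx
  exact ⟨PiNat.cylinder x n, ⟨x, n, rfl⟩, PiNat.self_mem_cylinder x n, fun y hy => hn y hy⟩

/-- If the set named by `κ x` misses the compact `S`, finitely many balls cover `S`, and these
depend only on a finite prefix of `x`. -/
theorem isClosed_setOf_closedOf_inter_nonempty {K : Baire →. Baire} (hK : IsComputable K)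
    {κ : Baire → Baire} (hκ : ∀ x, κ x ∈ K x) {S : Set ℝ} (hS : IsCompact S) :
    IsClosed {x | ((closedOf (κ x) : Set ℝ) ∩ S).Nonempty} := by
  rw [← isOpen_compl_iff]
  refine isOpen_of_cylinder_subset fun x hx => ?_
  have hcover : S ⊆ ⋃ i, ratBall (κ x i) := by
    intro y hy
    by_contra hy'
    exact hx ⟨y, hy', hy⟩
  obtain ⟨T, hT⟩ := hS.elim_finite_subcover _ (fun i => Metric.isOpen_ball) hcover
  obtain ⟨k, hk⟩ := hK.exists_modulus (hκ x) (T.sup id + 1)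
  refine ⟨k, fun x' hx' => ?_⟩
  rintro ⟨y, hy, hyS⟩
  obtain ⟨i, hi, hyi⟩ := Set.mem_iUnion₂.1 (hT hyS)
  rw [← hk x' (κ x') hx' (hκ x') i (Nat.lt_succ_of_le (Finset.le_sup (f := id) hi))] at hyi
  exact mem_closedOf.1 hy i hyi

/-- A ball removed from the set of `κ x` is also removed for all inputs close to `x`, so it cannot
contain a limit of points of their sets. -/
theorem mem_closedOf_of_tendsto {K : Baire →. Baire} (hK : IsComputable K)
    {κ : Baire → Baire} (hκ : ∀ x, κ x ∈ K x) {x : Baire} {x' : ℕ → Baire}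
    (hx' : ∀ k, ∀ i < k, x' k i = x i) {y : ℕ → ℝ} (hy : ∀ k, y k ∈ closedOf (κ (x' k)))
    {φ : ℕ → ℕ} (hφ : StrictMono φ) {a : ℝ}
    (ha : Filter.Tendsto (y ∘ φ) Filter.atTop (nhds a)) : a ∈ closedOf (κ x) := by
  refine mem_closedOf.2 fun i hai => ?_
  obtain ⟨k, hk⟩ := hK.exists_modulus (hκ x) (i + 1)
  have hev := ha.eventually (Metric.isOpen_ball.mem_nhds hai)
  obtain ⟨j, hj, hkj⟩ := (hev.and (Filter.eventually_ge_atTop k)).exists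
  have heq := hk (x' (φ j)) _ (fun l hl => hx' _ l (hl.trans_le (hkj.trans (hφ.le_apply))))
    (hκ _) i (Nat.lt_succ_self i)
  refine mem_closedOf.1 (hy (φ j)) i ?_
  rw [heq]
  exact hj

theorem not_C_reducible_closedChoice : ¬ Reducible C closedChoice := by
  rintro ⟨H, K, hH, hK, hHK⟩
  -- A realizer may take any admissible value `v` at the single name `p`, so `H` has to cope with
  -- each such `v`.
  have hval : ∀ (x p : Baire), p ∈ K x → ∀ v : Part Baire, ((closedOf p : Set ℝ).Nonempty →
      ∃ q ∈ v, ∃ y ∈ closedOf p, realRep.Names q y) →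
      ∃ r ∈ v, ∃ q ∈ H (pair x r), ∀ i j, q (Nat.pair i j) = 0 ↔ ∃ k, x (Nat.pair i k) = 0 := by
    intro x p hp v hv
    obtain ⟨G, hG, hGv⟩ := exists_closedChoice_realizer p v hv
    obtain ⟨F, hF, rfl⟩ := hHK G hG
    obtain ⟨q, hq, hq'⟩ := exists_mem_of_realizes_C hF x
    obtain ⟨p', hp', hq⟩ := Part.mem_bind_iff.1 hq
    obtain rfl := Part.mem_unique hp hp'
    obtain ⟨r, hr, hq⟩ := Part.mem_bind_iff.1 hq
    exact ⟨r, hGv ▸ hr, q, hq, hq'⟩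
  have hKdom : ∀ x, ∃ p, p ∈ K x := by
    intro x
    obtain ⟨G, hG, -⟩ := exists_closedChoice_realizer 0
      ⟨∃ q, ∃ y ∈ closedOf 0, realRep.Names q y, fun h => h.choose⟩ (by
        rintro ⟨y, hy⟩
        obtain ⟨q, hq⟩ := realRep.surj y
        have h : ∃ q, ∃ y ∈ closedOf 0, realRep.Names q y := ⟨q, y, hy, hq⟩
        exact ⟨h.choose, ⟨h, rfl⟩, h.choose_spec⟩)
    obtain ⟨F, hF, rfl⟩ := hHK G hG
    obtain ⟨q, hq, -⟩ := exists_mem_of_realizes_C hF x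
    obtain ⟨p, hp, -⟩ := Part.mem_bind_iff.1 hq
    exact ⟨p, hp⟩
  choose κ hκ using hKdom
  -- On a name of the empty set a realizer may be undefined, but the composite must be defined
  -- because `C` is total.
  have hne : ∀ x, (closedOf (κ x) : Set ℝ).Nonempty := by
    intro x
    by_contra h
    obtain ⟨r, hr, -⟩ := hval x (κ x) (hκ x) Part.none fun h' => absurd h' h
    exact Part.notMem_none r hr
  have hsolve : ∀ x r y, y ∈ closedOf (κ x) → realRep.Names r y →
      ∃ q ∈ H (pair x r), ∀ i j, q (Nat.pair i j) = 0 ↔ ∃ k, x (Nat.pair i k) = 0 := by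
    intro x r y hy hr
    obtain ⟨r', hr', h⟩ := hval x (κ x) (hκ x) (Part.some r)
      fun _ => ⟨r, Part.mem_some r, y, hy, hr⟩
    rwa [Part.mem_some_iff.1 hr'] at h
  obtain ⟨n, x₀, hx₀⟩ := nonempty_interior_of_iUnion_of_closed
    (f := fun n : ℕ => {x | ((closedOf (κ x) : Set ℝ) ∩ Set.Icc (-n : ℝ) n).Nonempty})
    (fun n => isClosed_setOf_closedOf_inter_nonempty hK hκ isCompact_Icc) (by
      refine Set.eq_univ_of_forall fun x => Set.mem_iUnion.2 ?_
      obtain ⟨y, hy⟩ := hne x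
      obtain ⟨n, hn⟩ := exists_nat_ge |y|
      exact ⟨n, y, hy, abs_le.1 hn⟩)
  obtain ⟨L, hL⟩ := exists_cylinder_subset isOpen_interior hx₀
  -- The cylinder fixes only places below `L`, and `Nat.pair L k ≥ L`, so instance `L` is untouched
  -- by it.
  let x : Baire := fun m => if m < L then x₀ m else 1
  let x' : ℕ → Baire := fun k m => if m < L then x₀ m else if m = Nat.pair L k then 0 else 1
  have hfresh : ∀ k, ¬ Nat.pair L k < L := fun k => (Nat.left_le_pair L k).not_gt
  have hxx' : ∀ k, ∀ i < k, x' k i = x i := by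
    intro k i hik
    have : i ≠ Nat.pair L k := (hik.trans_le (Nat.right_le_pair L k)).ne
    simp [x, x', this]
  have hx0 : ¬ ∃ k, x (Nat.pair L k) = 0 := by simp [x, hfresh]
  have hx'0 : ∀ k, ∃ j, x' k (Nat.pair L j) = 0 := fun k => ⟨k, by simp [x', hfresh]⟩
  have hmeet : ∀ k, ((closedOf (κ (x' k)) : Set ℝ) ∩ Set.Icc (-n : ℝ) n).Nonempty := by
    intro k
    have hk := interior_subset (hL (x' k) fun i hi => by simp [x', hi])
    exact hk
  choose y hy hyn using hmeet
  obtain ⟨a, -, φ, hφ, ha⟩ := isCompact_Icc.tendsto_subseq hyn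
  have haA := mem_closedOf_of_tendsto hK hκ hxx' hy hφ ha
  obtain ⟨r, hr⟩ := exists_abs_nuQ_sub_lt a
  obtain ⟨q, hq, hq0⟩ := hsolve x r a haA (realRep_names_of_abs_lt hr)
  obtain ⟨M, hM⟩ := hH.exists_modulus hq (Nat.pair L 0 + 1)
  have hclose : ∀ᶠ j in Filter.atTop, ∀ i < M,
      |(nuQ (r i) : ℝ) - y (φ j)| < (1 / 2) ^ (i + 1) := by
    refine (Set.finite_lt_nat M).eventually_all.2 fun i _ => ?_
    have h : Filter.Tendsto (fun j => |(nuQ (r i) : ℝ) - y (φ j)|) Filter.atTop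
        (nhds |(nuQ (r i) : ℝ) - a|) := (tendsto_const_nhds.sub ha).abs
    exact h.eventually_lt_const (hr i)
  obtain ⟨j, hj, hMj⟩ := (hclose.and (Filter.eventually_ge_atTop M)).exists
  obtain ⟨s, hs⟩ := exists_abs_nuQ_sub_lt (y (φ j))
  -- The prefix of length `M` of the name of `a` is continued to a name of `y (φ j)`; `H` cannot
  -- tell the difference at place `⟨L, 0⟩`.
  obtain ⟨q', hq', hq'0⟩ := hsolve (x' (φ j)) (fun i => if i < M then r i else s i) (y (φ j)) (hy _)
    (realRep_names_of_abs_lt fun i => by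
      by_cases hi : i < M
      · simpa only [if_pos hi] using hj i hi
      · simpa only [if_neg hi] using hs i)
  have hagree := hM _ q' (fun i hi => ?_) hq' (Nat.pair L 0) (Nat.lt_succ_self _)
  · exact hx0 ((hq0 L 0).1 (hagree ▸ (hq'0 L 0).2 (hx'0 _)))
  · have hi2 : i / 2 < M := (Nat.div_le_self i 2).trans_lt hi
    simp only [pair, if_pos hi2, hxx' (φ j) (i / 2) (hi2.trans_le (hMj.trans hφ.le_apply))]

end Weihrauch

theorem mainTheorem8 : Weihrauch.StrictReducible Weihrauch.closedChoice Weihrauch.C :=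
  ⟨Weihrauch.closedChoice_reducible_C, Weihrauch.not_C_reducible_closedChoice⟩
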